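/- Let $X_1,X_2,\dots$ and $Y_1,Y_2,\dots$ be two independent sequences of i.i.d. random variables, the $X_i$ exponential with mean $\theta_1>0$ and the $Y_i$ exponential with mean $\theta_2>0$. For the sequence $X$ let $T_1=1$, $T_n=\min\{j: X_j>X_{T_{n-1}}\}$ for $n\ge 2$, and let $X_{U(n)}=X_{T_n}$ be the $n$-th upper record value; define $Y_{U(n)}$ likewise. Let $n_1,n_2\ge 1$ be integers and put $$\hat\theta_1=\frac{X_{U(n_1)}}{n_1},\qquad \hat\theta_2=\frac{Y_{U(n_2)}}{n_2},\qquad \hat\theta_p=\frac{n_1\hat\theta_1+n_2\hat\theta_2}{n_1+n_2}.$$ For $0<\alpha\le 1$ let $c_1$ and $c_2$ be the $\alpha/2$- and $(1-\alpha/2)$-quantiles of the $F$ distribution with $(2n_1,2n_2)$ degrees of freedom. For $K\in\mathbb R$ the preliminary test shrinkage estimator of $\theta_1$ is $$\hat\theta_S=\begin{cases}K\hat\theta_p+(1-K)\hat\theta_1 & \text{if } c_1<\hat\theta_1/\hat\theta_2<c_2,\\ \hat\theta_1 & \text{otherwise.}\end{cases}$$ Let $\lambda=\frac{n_2}{n_1+n_2}$,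 $\delta=\frac{\theta_2}{\theta_1}$, $d_i=1-\frac{n_2}{n_2+c_i n_1\delta}$ for $i=1,2$, let $I_d(a,b)=\frac{1}{B(a,b)}\int_0^d x^{a-1}(1-x)^{b-1}\,dx$ be the regularized incomplete beta function, and write $J(a,b)=I_{d_2}(a,b)-I_{d_1}(a,b)$. Then $\hat\theta_S$ and $(\hat\theta_S-\theta_1)^2$ are integrable and (i) the bias is $$E(\hat\theta_S)-\theta_1=-K\lambda\,\theta_1 J(n_1+1,n_2)+K\lambda\,\theta_2 J(n_1,n_2+1);$$ (ii) the mean square error $\mathrm{MSE}(\hat\theta_S)=E\big[(\hat\theta_S-\theta_1)^2\big]$ is $$\begin{aligned}\mathrm{MSE}(\hat\theta_S)={}&\frac{n_1+1}{n_1}\theta_1^2+(K^2\lambda^2-2K\lambda)\,\theta_1^2\,\frac{n_1+1}{n_1}J(n_1+2,n_2)+K^2\lambda^2\theta_2^2\,\frac{n_2+1}{n_2}J(n_1,n_2+2)\\&+2(K\lambda-K^2\lambda^2)\,\theta_1\theta_2 J(n_1+1,n_2+1)-2\theta_1^2-2K\lambda\,\theta_1\theta_2 J(n_1,n_2+1)+2K\lambda\,\theta_1^2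 J(n_1+1,n_2)+\theta_1^2.\end{aligned}$$ -/

import Mathlib

open MeasureTheory ProbabilityTheory

/-- Upper record times of a real sequence. Both the sequence and the records are indexed from `0`:
`x 0, x 1, …` are the observations `X₁, X₂, …` and `recordTime x k` is the (shifted) index of the
`(k+1)`-st record. The set is empty only if there is no further record, which has probability zero
for i.i.d. exponential observations. -/
noncomputable def recordTime (x : ℕ → ℝ) : ℕ → ℕ
  | 0 => 0
  | k + 1 => sInf {j : ℕ | x (recordTime x k) < x j}

/-- The `n`-th upper record value, `n = 1, 2, …`. -/
noncomputable def upperRecord (x : ℕ → ℝ) (n : ℕ) : ℝ :=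
  x (recordTime x (n - 1))

/-- The maximum likelihood estimator of the exponential scale parameter from the first `n`
upper record values: the `n`-th record value divided by `n`. -/
noncomputable def scaleMLE (x : ℕ → ℝ) (n : ℕ) : ℝ :=
  upperRecord x n / n

/-- The pooled estimator `(n₁ t₁ + n₂ t₂) / (n₁ + n₂)`. -/
noncomputable def pooledEstimator (n₁ n₂ : ℕ) (t₁ t₂ : ℝ) : ℝ :=
  (n₁ * t₁ + n₂ * t₂) / (n₁ + n₂)

/-- The chi-square distribution with `k` degrees of freedom. -/
noncomputable def chiSquareMeasure (k : ℕ) : Measure ℝ :=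
  gammaMeasure ((k : ℝ) / 2) (1 / 2)

/-- Fisher's F distribution with `(k, l)` degrees of freedom: the law of `(U / k) / (V / l)` for
independent chi-square variables `U`, `V` with `k` and `l` degrees of freedom. -/
noncomputable def fisherMeasure (k l : ℕ) : Measure ℝ :=
  ((chiSquareMeasure k).prod (chiSquareMeasure l)).map (fun p => (p.1 / k) / (p.2 / l))

/-- The `p`-quantile of a probability measure on the real line, for `0 < p < 1`. -/
noncomputable def quantile (μ : Measure ℝ) (p : ℝ) : ℝ :=
  sInf {x : ℝ | p ≤ cdf μ x}

/-- The critical values of the level-`α` equal-tailed F test. -/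
noncomputable def critLower (n₁ n₂ : ℕ) (α : ℝ) : ℝ :=
  quantile (fisherMeasure (2 * n₁) (2 * n₂)) (α / 2)

noncomputable def critUpper (n₁ n₂ : ℕ) (α : ℝ) : ℝ :=
  quantile (fisherMeasure (2 * n₁) (2 * n₂)) (1 - α / 2)

open Classical in
/-- The preliminary test shrinkage estimator of the first scale parameter, computed from the two
observation sequences `x` and `y` through their first `n₁` and `n₂` upper record values. -/
noncomputable def shrinkageEstimator (n₁ n₂ : ℕ) (α K : ℝ) (x y : ℕ → ℝ) : ℝ :=
  if critLower n₁ n₂ α < scaleMLE x n₁ / scaleMLE y n₂ ∧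
      scaleMLE x n₁ / scaleMLE y n₂ < critUpper n₁ n₂ α then
    K * pooledEstimator n₁ n₂ (scaleMLE x n₁) (scaleMLE y n₂) + (1 - K) * scaleMLE x n₁
  else scaleMLE x n₁

/-- The (regularized) incomplete beta function
`I_d(a, b) = B(a, b)⁻¹ ∫₀ᵈ x^(a-1) (1-x)^(b-1) dx`. -/
noncomputable def incompleteBeta (d a b : ℝ) : ℝ :=
  (∫ x in (0 : ℝ)..d, x ^ (a - 1) * (1 - x) ^ (b - 1)) / beta a b

open Set Filter
open scoped ENNReal

/-! The estimator depends on the data only through the records `u = X_{U(n₁)}` and `v = Y_{U(n₂)}`: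
it equals `u/n₁ + Kλ 1_A (v/n₂ - u/n₁)`, where `A` is a cone `s < u/v < t`
(`shrinkageEstimator_eq`). Bias and mean square error are therefore linear combinations of moments
`E[u^i]` and `E[u^i v^j 1_A]` with `i + j ≤ 2`.

The records are independent gamma variables with shapes `n₁`, `n₂` and rates `1/θ₁`, `1/θ₂`. To see
this, condition on the first observation: below the current level it is ignored, above it it becomes
the new record and the search restarts. Solving the resulting identity for exponential variables and
inducting on the number of records gives `infinitePi_expMeasure_iterate_nextRecord`.

Weighting a gamma law by `u^i` only raises its shape by `i`, up to the constant `gammaMoment`. Each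
truncated moment is thus a constant times the probability of `A` under gamma laws with raised shapes
(`integrableOn_and_setIntegral_pow_mul_pow`), and that probability is a difference of incomplete
beta values (`gammaMeasure_prod_ratio_Ioo`). About the critical values only `0 ≤ c₁ ≤ c₂` is needed.
-/

/-- The first term of the sequence `x` that exceeds the level `a`. -/
noncomputable def nextRecord (x : ℕ → ℝ) (a : ℝ) : ℝ :=
  x (sInf {j : ℕ | a < x j})

/-- Put a real number in front of a sequence. -/
def consSeq (p : ℝ × (ℕ → ℝ)) : ℕ → ℝ
  | 0 => p.1
  | n + 1 => p.2 n

/-! ### Pathwise properties of records -/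

theorem upperRecord_eq_iterate_nextRecord (x : ℕ → ℝ) (n : ℕ) :
    upperRecord x n = (nextRecord x)^[n - 1] (x 0) := by
  have h : ∀ k, x (recordTime x k) = (nextRecord x)^[k] (x 0) := by
    intro k
    induction k with
    | zero => rfl
    | succ k ih =>
      rw [Function.iterate_succ_apply', ← ih]
      rfl
  exact h (n - 1)

/-- Starting at level `0` lets the first observation count as a record step too, so the gamma shape
will be `n` rather than `n - 1`. -/
theorem upperRecord_eq_iterate_nextRecord_zero (x : ℕ → ℝ) (hx : 0 < x 0) (n : ℕ) (hn : 1 ≤ n) :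
    upperRecord x n = (nextRecord x)^[n] 0 := by
  obtain ⟨k, rfl⟩ : ∃ k, n = k + 1 := ⟨n - 1, by omega⟩
  have h0 : nextRecord x 0 = x 0 := by
    have : sInf {j : ℕ | 0 < x j} = 0 := Nat.sInf_eq_zero.2 (Or.inl hx)
    rw [nextRecord, this]
  rw [upperRecord_eq_iterate_nextRecord, Function.iterate_succ_apply, h0, Nat.add_sub_cancel]

theorem lt_nextRecord {x : ℕ → ℝ} (hx : ∀ b, ∃ j, b < x j) (a : ℝ) : a < nextRecord x a :=
  Nat.sInf_mem (s := {j : ℕ | a < x j}) (hx a)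

theorem nextRecord_consSeq_of_lt {p : ℝ × (ℕ → ℝ)} {a : ℝ} (h : a < p.1) :
    nextRecord (consSeq p) a = p.1 := by
  have : sInf {j : ℕ | a < consSeq p j} = 0 := Nat.sInf_eq_zero.2 (Or.inl h)
  rw [nextRecord, this, consSeq]

/-- A skipped head shifts the index by one and leaves the value alone. Unboundedness of the tail
matters: with no exceedance, the convention `sInf ∅ = 0` would return the head on one side and the
first tail term on the other. -/
theorem nextRecord_consSeq_of_le {p : ℝ × (ℕ → ℝ)} (hp : ∀ b, ∃ j, b < p.2 j) {a : ℝ}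
    (h : p.1 ≤ a) : nextRecord (consSeq p) a = nextRecord p.2 a := by
  have h0 : 0 ∉ {j : ℕ | a < consSeq p j} := by simpa [consSeq] using h
  have hne : {j : ℕ | a < p.2 j}.Nonempty := hp a
  have : sInf {j : ℕ | a < consSeq p j} = sInf {j : ℕ | a < p.2 j} + 1 := by
    apply le_antisymm
    · exact Nat.sInf_le (show a < consSeq p _ from Nat.sInf_mem hne)
    · have hne' : {j : ℕ | a < consSeq p j}.Nonempty := (hp a).imp' Nat.succ fun j hj => hj
      have hmem := Nat.sInf_mem hne'
      generalize sInf {j : ℕ | a < consSeq p j} = m at hmem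
      cases m with
      | zero => exact absurd hmem h0
      | succ m => exact Nat.succ_le_succ (Nat.sInf_le hmem)
  rw [nextRecord, this, consSeq, nextRecord]

theorem iterate_nextRecord_consSeq_of_le {p : ℝ × (ℕ → ℝ)} (hp : ∀ b, ∃ j, b < p.2 j) (n : ℕ)
    {a : ℝ} (h : p.1 ≤ a) :
    (nextRecord (consSeq p))^[n] a = (nextRecord p.2)^[n] a := by
  induction n generalizing a with
  | zero => rfl
  | succ n ih =>
    rw [Function.iterate_succ_apply, Function.iterate_succ_apply, nextRecord_consSeq_of_le hp h,
      ih (h.trans (lt_nextRecord hp a).le)]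

theorem iterate_nextRecord_consSeq_of_lt {p : ℝ × (ℕ → ℝ)} (hp : ∀ b, ∃ j, b < p.2 j) (n : ℕ)
    {a : ℝ} (h : a < p.1) :
    (nextRecord (consSeq p))^[n + 1] a = (nextRecord p.2)^[n] p.1 := by
  rw [Function.iterate_succ_apply, nextRecord_consSeq_of_lt h,
    iterate_nextRecord_consSeq_of_le hp n le_rfl]

/-! ### Measurability of records -/

theorem measurable_nextRecord :
    Measurable (fun p : ℝ × (ℕ → ℝ) => nextRecord p.2 p.1) := by
  have hlt : ∀ j : ℕ, MeasurableSet {p : ℝ × (ℕ → ℝ) | p.1 < p.2 j} := fun j =>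
    measurableSet_lt (by fun_prop) (by fun_prop)
  have hN : Measurable (fun p : ℝ × (ℕ → ℝ) => sInf {j : ℕ | p.1 < p.2 j}) := by
    refine measurable_of_Iio fun k => ?_
    -- The second piece collects the points with no exceedance, where `sInf ∅ = 0`.
    have : (fun p : ℝ × (ℕ → ℝ) => sInf {j : ℕ | p.1 < p.2 j}) ⁻¹' Iio k
        = (⋃ j ∈ Iio k, {p | p.1 < p.2 j}) ∪ ((⋂ j, {p | p.1 < p.2 j}ᶜ) ∩ {_p | 0 < k}) := by
      ext p
      simp only [mem_preimage, mem_Iio, mem_union, mem_iUnion, mem_ofPred_eq, mem_inter_iff,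
        mem_iInter, mem_compl_iff, exists_prop]
      constructor
      · intro h
        by_cases hne : {j : ℕ | p.1 < p.2 j}.Nonempty
        · exact Or.inl ⟨_, h, Nat.sInf_mem hne⟩
        · exact Or.inr ⟨fun j hj => hne ⟨j, hj⟩, by omega⟩
      · rintro (⟨j, hj, hp⟩ | ⟨h, hk⟩)
        · exact (Nat.sInf_le hp).trans_lt hj
        · have : {j : ℕ | p.1 < p.2 j} = ∅ := by ext j; simpa using h j
          simpa [this] using hk
    rw [this]
    exact (MeasurableSet.biUnion (to_countable _) fun j _ => hlt j).union
      ((MeasurableSet.iInter fun j => (hlt j).compl).inter (MeasurableSet.const _))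
  have hev : Measurable (fun q : ℕ × (ℕ → ℝ) => q.2 q.1) :=
    measurable_from_prod_countable_right fun j => measurable_pi_apply j
  exact hev.comp (hN.prodMk measurable_snd)

theorem measurable_iterate_nextRecord (n : ℕ) :
    Measurable (fun p : ℝ × (ℕ → ℝ) => (nextRecord p.2)^[n] p.1) := by
  induction n with
  | zero => exact measurable_fst
  | succ n ih =>
    simp_rw [Function.iterate_succ_apply']
    exact measurable_nextRecord.comp (ih.prodMk measurable_snd)

theorem measurable_upperRecord (n : ℕ) : Measurable (fun x : ℕ → ℝ => upperRecord x n) := by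
  simp_rw [upperRecord_eq_iterate_nextRecord]
  have h : Measurable fun x : ℕ → ℝ => (x 0, x) := (measurable_pi_apply 0).prodMk measurable_id
  exact (measurable_iterate_nextRecord (n - 1)).comp h

theorem measurable_consSeq : Measurable consSeq := by
  refine measurable_pi_iff.2 fun n => ?_
  cases n with
  | zero => exact measurable_fst
  | succ n => exact (measurable_pi_apply n).comp measurable_snd

/-! ### I.i.d. sequences and conditioning on the first term -/

theorem map_consSeq_prod_infinitePi (ν : Measure ℝ) [IsProbabilityMeasure ν] :
    (ν.prod (Measure.infinitePi fun _ : ℕ => ν)).map consSeq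
      = Measure.infinitePi fun _ : ℕ => ν := by
  classical
  refine Measure.eq_infinitePi _ fun s t ht => ?_
  obtain ⟨N, hN⟩ := s.exists_nat_subset_range
  -- Padding by `univ` turns a box over an arbitrary finite index set into one over an initial
  -- segment, which splits into head and tail.
  let t' : ℕ → Set ℝ := fun i => if i ∈ s then t i else univ
  have ht' : ∀ i, MeasurableSet (t' i) := fun i => by
    by_cases hi : i ∈ s <;> simp [t', hi, ht]
  have hpre : consSeq ⁻¹' (Set.pi s t)
      = t' 0 ×ˢ Set.pi (Finset.range N) (fun i => t' (i + 1)) := by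
    ext p
    simp only [mem_preimage, Set.mem_pi, Finset.mem_coe, mem_prod, Finset.mem_range, t']
    constructor
    · intro h
      refine ⟨?_, fun i _ => ?_⟩
      · split_ifs with h0
        exacts [h 0 h0, mem_univ _]
      · split_ifs with h0
        exacts [h (i + 1) h0, mem_univ _]
    · rintro ⟨h0, h1⟩ i hi
      cases i with
      | zero => simpa [hi, consSeq] using h0
      | succ i =>
        have := h1 i (by have := Finset.mem_range.1 (hN hi); omega)
        simpa [hi, consSeq] using this
  rw [Measure.map_apply measurable_consSeq (MeasurableSet.pi s.countable_toSet fun i _ => ht i),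
    hpre, Measure.prod_prod, Measure.infinitePi_pi _ fun i _ => ht' (i + 1), mul_comm,
    ← Finset.prod_range_succ' (fun i => ν (t' i))]
  rw [← Finset.prod_subset (hN.trans (Finset.range_subset_range.2 N.le_succ))]
  · exact Finset.prod_congr rfl fun i hi => by simp [t', hi]
  · intro i _ hi
    simp [t', hi]

/-- The first `m` terms all stay below `N` with probability `ν (Iic N) ^ m`, which tends to `0`;
integer levels suffice. -/
theorem ae_infinitePi_forall_exists_lt (ν : Measure ℝ) [IsProbabilityMeasure ν]
    (hν : ∀ a, ν (Iic a) < 1) :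
    ∀ᵐ x ∂(Measure.infinitePi fun _ : ℕ => ν), ∀ b, ∃ j, b < x j := by
  have h : ∀ N : ℕ, ∀ᵐ x ∂(Measure.infinitePi fun _ : ℕ => ν), ∃ j, (N : ℝ) < x j := by
    intro N
    rw [ae_iff]
    refine le_antisymm (ge_of_tendsto' (ENNReal.tendsto_pow_atTop_nhds_zero_of_lt_one (hν N))
      fun m => ?_) bot_le
    have := Measure.infinitePi_pi (fun _ : ℕ => ν) (s := Finset.range m)
      (t := fun _ => Iic (N : ℝ)) fun _ _ => measurableSet_Iic
    rw [Finset.prod_const, Finset.card_range] at this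
    rw [← this]
    refine measure_mono fun x hx i _ => ?_
    simp only [mem_ofPred_eq, not_exists, not_lt] at hx
    exact hx i
  filter_upwards [ae_all_iff.2 h] with x hx b
  obtain ⟨N, hN⟩ := exists_nat_gt b
  exact (hx N).imp fun j hj => hN.trans hj

/-- Conditioning on the first observation. -/
theorem infinitePi_iterate_nextRecord_mul (ν : Measure ℝ) [IsProbabilityMeasure ν]
    (hν : ∀ a, ν (Iic a) < 1) (n : ℕ) (a : ℝ) {B : Set ℝ} (hB : MeasurableSet B) :
    (Measure.infinitePi fun _ : ℕ => ν) {x | (nextRecord x)^[n + 1] a ∈ B} * ν (Ioi a)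
      = ∫⁻ b in Ioi a, (Measure.infinitePi fun _ : ℕ => ν) {x | (nextRecord x)^[n] b ∈ B} ∂ν := by
  set π := Measure.infinitePi fun _ : ℕ => ν with hπ
  set m := π {x | (nextRecord x)^[n + 1] a ∈ B} with hm
  have hE : MeasurableSet {x : ℕ → ℝ | (nextRecord x)^[n + 1] a ∈ B} :=
    ((measurable_iterate_nextRecord (n + 1)).comp
      (measurable_const.prodMk measurable_id)) hB
  have key : m = ∫⁻ b, π {y | (nextRecord (consSeq (b, y)))^[n + 1] a ∈ B} ∂ν := by
    rw [hm, hπ]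
    conv_lhs => rw [← map_consSeq_prod_infinitePi ν]
    rw [Measure.map_apply measurable_consSeq hE,
      Measure.prod_apply (measurable_consSeq hE)]
    rfl
  have hunb := ae_infinitePi_forall_exists_lt ν hν
  rw [← lintegral_add_compl _ (measurableSet_Ioi (a := a)), compl_Ioi] at key
  have h1 : ∫⁻ b in Ioi a, π {y | (nextRecord (consSeq (b, y)))^[n + 1] a ∈ B} ∂ν
      = ∫⁻ b in Ioi a, π {x | (nextRecord x)^[n] b ∈ B} ∂ν := by
    refine setLIntegral_congr_fun measurableSet_Ioi fun b hb => measure_congr ?_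
    filter_upwards [hunb] with y hy
    have := iterate_nextRecord_consSeq_of_lt (p := (b, y)) hy n hb
    exact congrArg (· ∈ B) this
  have h2 : ∫⁻ b in Iic a, π {y | (nextRecord (consSeq (b, y)))^[n + 1] a ∈ B} ∂ν
      = m * ν (Iic a) := by
    rw [setLIntegral_congr_fun (g := fun _ => m) measurableSet_Iic, setLIntegral_const]
    intro b hb
    refine measure_congr ?_
    filter_upwards [hunb] with y hy
    have := iterate_nextRecord_consSeq_of_le (p := (b, y)) hy (n + 1) hb
    exact congrArg (· ∈ B) this
  rw [h1, h2] at key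
  -- The skipped observations reproduce the unknown `m` with weight `ν (Iic a)`; subtracting this
  -- finite term leaves `m * ν (Ioi a)`.
  have htot : m * ν (Ioi a) + m * ν (Iic a) = m := by
    rw [← mul_add, ← compl_Ioi, measure_add_measure_compl measurableSet_Ioi, measure_univ, mul_one]
  have hfin : m * ν (Iic a) ≠ ∞ :=
    ENNReal.mul_ne_top (measure_ne_top _ _) (measure_ne_top _ _)
  exact (ENNReal.add_left_inj hfin).1 (htot.trans key)

/-! ### Gamma law of exponential records -/

theorem expMeasure_Iic {r : ℝ} (hr : 0 < r) (a : ℝ) :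
    expMeasure r (Iic a) = ENNReal.ofReal (if 0 ≤ a then 1 - Real.exp (-(r * a)) else 0) := by
  have := isProbabilityMeasure_expMeasure hr
  rw [← cdf_expMeasure_eq hr, ofReal_cdf]

theorem expMeasure_Iic_lt_one {r : ℝ} (hr : 0 < r) (a : ℝ) : expMeasure r (Iic a) < 1 := by
  rw [expMeasure_Iic hr, ENNReal.ofReal_lt_one]
  split_ifs
  · linarith [Real.exp_pos (-(r * a))]
  · norm_num

theorem expMeasure_Ioi {r : ℝ} (hr : 0 < r) {a : ℝ} (ha : 0 ≤ a) :
    expMeasure r (Ioi a) = ENNReal.ofReal (Real.exp (-(r * a))) := by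
  have := isProbabilityMeasure_expMeasure hr
  have hle : Real.exp (-(r * a)) ≤ 1 := Real.exp_le_one_iff.2 (by nlinarith)
  rw [← compl_Iic, prob_compl_eq_one_sub measurableSet_Iic, expMeasure_Iic hr, if_pos ha,
    ← ENNReal.ofReal_one, ← ENNReal.ofReal_sub _ (by linarith)]
  congr 1
  ring

@[fun_prop]
theorem measurable_gammaPDF (a r : ℝ) : Measurable (gammaPDF a r) :=
  (measurable_gammaPDFReal a r).ennreal_ofReal

theorem gammaPDF_natCast_add_one {r x : ℝ} (hx : 0 ≤ x) (n : ℕ) :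
    gammaPDF (n + 1) r x
      = ENNReal.ofReal (r ^ (n + 1) / n.factorial * x ^ n * Real.exp (-(r * x))) := by
  rw [gammaPDF_of_nonneg hx, Real.Gamma_nat_eq_factorial, add_sub_cancel_right,
    Real.rpow_natCast]
  norm_cast

/-- The exponentials combine to `exp (-r y)`, free of `x`, so only a power of `y - x` is integrated.
The factor `exp (-r a)` is split off because it is the probability of exceeding `a`, which cancels
in the induction. -/
theorem lintegral_Ioo_gammaPDF_mul {r : ℝ} (hr : 0 < r) (n : ℕ) {a y : ℝ} (ha : 0 ≤ a)
    (hay : a ≤ y) :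
    ∫⁻ x in Ioo a y, gammaPDF 1 r x * gammaPDF (n + 1) r (y - x)
      = gammaPDF ((n + 1 : ℕ) + 1) r (y - a) * ENNReal.ofReal (Real.exp (-(r * a))) := by
  have h1 : ∀ x ∈ Ioo a y, gammaPDF 1 r x * gammaPDF (n + 1) r (y - x)
      = ENNReal.ofReal (r ^ (n + 2) / n.factorial * Real.exp (-(r * y)) * (y - x) ^ n) := by
    rintro x ⟨hx, hxy⟩
    have hg : gammaPDF 1 r x = ENNReal.ofReal (r * Real.exp (-(r * x))) := by
      rw [gammaPDF_of_nonneg (by linarith)]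
      simp
    rw [hg, gammaPDF_natCast_add_one (by linarith), ← ENNReal.ofReal_mul (by positivity)]
    congr 1
    have : Real.exp (-(r * y)) = Real.exp (-(r * x)) * Real.exp (-(r * (y - x))) := by
      rw [← Real.exp_add]; congr 1; ring
    rw [this]
    ring
  rw [setLIntegral_congr_fun measurableSet_Ioo h1, gammaPDF_natCast_add_one (by linarith),
    ← ENNReal.ofReal_mul (by have := sub_nonneg.2 hay; positivity),
    ← ofReal_integral_eq_lintegral_ofReal]
  · congr 1
    rw [← integral_Ioc_eq_integral_Ioo, ← intervalIntegral.integral_of_le hay,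
      intervalIntegral.integral_const_mul,
      intervalIntegral.integral_comp_sub_left (fun z => z ^ n) y, sub_self, integral_pow]
    have : Real.exp (-(r * y)) = Real.exp (-(r * (y - a))) * Real.exp (-(r * a)) := by
      rw [← Real.exp_add]; congr 1; ring
    rw [this, Nat.factorial_succ]
    push_cast
    field_simp
    simp
  · refine Continuous.integrableOn_Icc (by fun_prop) |>.mono_set Ioo_subset_Icc_self
  · refine (ae_restrict_iff' measurableSet_Ioo).2 (ae_of_all _ fun x hx => ?_)
    have := sub_nonneg.2 hx.2.le
    positivity

/-- Starting from level `a ≥ 0`, the `(n + 1)`-st record of an exponential sequence is `a` plus a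
gamma variable. -/
theorem infinitePi_expMeasure_iterate_nextRecord {r : ℝ} (hr : 0 < r) (n : ℕ) {a : ℝ}
    (ha : 0 ≤ a) {B : Set ℝ} (hB : MeasurableSet B) :
    (Measure.infinitePi fun _ : ℕ => expMeasure r) {x | (nextRecord x)^[n + 1] a ∈ B}
      = ∫⁻ y in Ioi a, B.indicator 1 y * gammaPDF (n + 1) r (y - a) := by
  have := isProbabilityMeasure_expMeasure hr
  have hexp0 : ENNReal.ofReal (Real.exp (-(r * a))) ≠ 0 := by simp [Real.exp_pos]
  have hBm : Measurable (B.indicator (1 : ℝ → ℝ≥0∞)) := measurable_one.indicator hB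
  induction n generalizing a with
  | zero =>
    have h := infinitePi_iterate_nextRecord_mul (expMeasure r) (expMeasure_Iic_lt_one hr) 0 a hB
    rw [expMeasure_Ioi hr ha] at h
    rw [← ENNReal.mul_left_inj hexp0 ENNReal.ofReal_ne_top, h, ← lintegral_mul_const _ (by fun_prop)]
    have h0 : ∀ b : ℝ, (Measure.infinitePi fun _ : ℕ => expMeasure r)
        {x | (nextRecord x)^[0] b ∈ B} = B.indicator 1 b := by
      intro b
      by_cases hb : b ∈ B <;> simp [hb]
    simp_rw [h0]
    rw [expMeasure, gammaMeasure, setLIntegral_withDensity_eq_setLIntegral_mul _ (by fun_prop)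
      hBm measurableSet_Ioi]
    refine setLIntegral_congr_fun measurableSet_Ioi fun y hy => ?_
    have hy : a < y := hy
    simp only [Pi.mul_apply]
    rw [mul_comm, mul_assoc]
    congr 1
    rw [gammaPDF_natCast_add_one (by linarith), gammaPDF_of_nonneg (by linarith),
      ← ENNReal.ofReal_mul (by positivity)]
    congr 1
    have : Real.exp (-(r * y)) = Real.exp (-(r * (y - a))) * Real.exp (-(r * a)) := by
      rw [← Real.exp_add]; congr 1; ring
    rw [this]
    simp
    ring
  | succ n ih =>
    have h := infinitePi_iterate_nextRecord_mul (expMeasure r) (expMeasure_Iic_lt_one hr)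
      (n + 1) a hB
    rw [expMeasure_Ioi hr ha] at h
    rw [← ENNReal.mul_left_inj hexp0 ENNReal.ofReal_ne_top, h, ← lintegral_mul_const _ (by fun_prop)]
    rw [setLIntegral_congr_fun (g := fun b =>
      ∫⁻ y in Ioi b, B.indicator 1 y * gammaPDF (n + 1) r (y - b)) measurableSet_Ioi
      fun b hb => ih (ha.trans (le_of_lt hb)) (by simp [Real.exp_pos])]
    -- The constraints `a < b < y` are encoded as indicators so that Tonelli can exchange the new
    -- record `b` with the final value `y`.
    have hD : Measurable ({q : ℝ × ℝ | q.1 < q.2}.indicator (1 : ℝ × ℝ → ℝ≥0∞)) :=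
      measurable_one.indicator (measurableSet_lt measurable_fst measurable_snd)
    have hjoint : Measurable (fun q : ℝ × ℝ => (Ioi a).indicator 1 q.1 *
        (gammaPDF 1 r q.1 * ({q : ℝ × ℝ | q.1 < q.2}.indicator 1 q *
          (B.indicator 1 q.2 * gammaPDF (n + 1) r (q.2 - q.1))))) := by
      have hA : Measurable ((Ioi a).indicator (1 : ℝ → ℝ≥0∞)) :=
        measurable_one.indicator measurableSet_Ioi
      fun_prop
    have hset : ∀ b, ∫⁻ y in Ioi b, B.indicator 1 y * gammaPDF (n + 1) r (y - b)
        = ∫⁻ y, {q : ℝ × ℝ | q.1 < q.2}.indicator 1 (b, y) *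
            (B.indicator 1 y * gammaPDF (n + 1) r (y - b)) := by
      intro b
      rw [← lintegral_indicator measurableSet_Ioi]
      refine lintegral_congr fun y => ?_
      by_cases hy : b < y <;> simp [hy]
    have hinner : ∀ b, (Ioi a).indicator 1 b * (gammaPDF 1 r b *
          ∫⁻ y in Ioi b, B.indicator 1 y * gammaPDF (n + 1) r (y - b))
        = ∫⁻ y, (Ioi a).indicator 1 b * (gammaPDF 1 r b *
          ({q : ℝ × ℝ | q.1 < q.2}.indicator 1 (b, y) *
            (B.indicator 1 y * gammaPDF (n + 1) r (y - b)))) := by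
      intro b
      rw [lintegral_const_mul _ (by fun_prop), lintegral_const_mul _ (by fun_prop), hset]
    have houter : ∀ y, ∫⁻ b, (Ioi a).indicator 1 b * (gammaPDF 1 r b *
          ({q : ℝ × ℝ | q.1 < q.2}.indicator 1 (b, y) *
            (B.indicator 1 y * gammaPDF (n + 1) r (y - b))))
        = (Ioi a).indicator (fun y => B.indicator 1 y * gammaPDF ((n + 1 : ℕ) + 1) r (y - a) *
            ENNReal.ofReal (Real.exp (-(r * a)))) y := by
      intro y
      by_cases hy : a < y
      · rw [indicator_of_mem (show y ∈ Ioi a from hy), mul_assoc,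
          ← lintegral_Ioo_gammaPDF_mul hr n ha hy.le, ← lintegral_const_mul _ (by fun_prop),
          ← lintegral_indicator measurableSet_Ioo]
        refine lintegral_congr fun b => ?_
        by_cases hb : a < b <;> by_cases hby : b < y <;> simp [hb, hby]
        ring
      · rw [indicator_of_notMem (show y ∉ Ioi a from hy), lintegral_eq_zero_iff' ?_]
        · refine ae_of_all _ fun b => ?_
          by_cases hb : a < b
          · have : ¬ b < y := fun h => hy (hb.trans h)
            simp [this]
          · simp [hb]
        · exact (hjoint.comp measurable_prodMk_right).aemeasurable
    have hG : Measurable (fun b => ∫⁻ y in Ioi b, B.indicator 1 y * gammaPDF (n + 1) r (y - b)) := by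
      have : Measurable (fun q : ℝ × ℝ => {q : ℝ × ℝ | q.1 < q.2}.indicator 1 q *
          (B.indicator 1 q.2 * gammaPDF (n + 1) r (q.2 - q.1))) := by fun_prop
      simp_rw [hset]
      exact this.lintegral_prod_right'
    rw [expMeasure, gammaMeasure, setLIntegral_withDensity_eq_setLIntegral_mul _ (by fun_prop)
      hG measurableSet_Ioi, ← lintegral_indicator measurableSet_Ioi,
      ← lintegral_indicator measurableSet_Ioi]
    simp_rw [← houter]
    rw [← lintegral_lintegral_swap hjoint.aemeasurable]
    simp_rw [← hinner]
    refine lintegral_congr fun b => ?_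
    by_cases hb : a < b <;> simp [hb]

theorem map_iterate_nextRecord_infinitePi_expMeasure {r : ℝ} (hr : 0 < r) (n : ℕ) (hn : 1 ≤ n) :
    (Measure.infinitePi fun _ : ℕ => expMeasure r).map (fun x => (nextRecord x)^[n] 0)
      = gammaMeasure n r := by
  obtain ⟨k, rfl⟩ : ∃ k, n = k + 1 := ⟨n - 1, by omega⟩
  ext B hB
  have hm : Measurable fun x : ℕ → ℝ => (nextRecord x)^[k + 1] 0 :=
    (measurable_iterate_nextRecord (k + 1)).comp (measurable_const.prodMk measurable_id)
  rw [Measure.map_apply hm hB]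
  refine (infinitePi_expMeasure_iterate_nextRecord hr k le_rfl hB).trans ?_
  rw [gammaMeasure, withDensity_apply _ hB, ← lintegral_indicator measurableSet_Ioi,
    ← lintegral_indicator hB]
  refine lintegral_congr_ae ?_
  filter_upwards [Measure.ae_ne volume (0 : ℝ)] with y hy
  rcases lt_or_gt_of_ne hy with h | h
  · have : ¬ 0 < y := not_lt.2 h.le
    by_cases hB : y ∈ B <;> simp [this, hB, gammaPDF_of_neg h]
  · by_cases hB : y ∈ B <;> simp [h, hB]

theorem hasLaw_upperRecord {Ω : Type*} [MeasurableSpace Ω] {P : Measure Ω}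
    [IsProbabilityMeasure P] {X : ℕ → Ω → ℝ} {r : ℝ} (hr : 0 < r)
    (hX : ∀ i, HasLaw (X i) (expMeasure r) P) (hind : iIndepFun X P) (n : ℕ) (hn : 1 ≤ n) :
    HasLaw (fun ω => upperRecord (fun i => X i ω) n) (gammaMeasure n r) P := by
  have := isProbabilityMeasure_expMeasure hr
  have h := hind.hasLaw_infinitePi hX (aemeasurable_pi_lambda _ fun i => (hX i).aemeasurable)
  have hm : Measurable fun x : ℕ → ℝ => (nextRecord x)^[n] 0 :=
    (measurable_iterate_nextRecord n).comp (measurable_const.prodMk measurable_id)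
  have h' : HasLaw (fun ω => (nextRecord (fun i => X i ω))^[n] 0) (gammaMeasure n r) P :=
    HasLaw.comp (Y := fun x : ℕ → ℝ => (nextRecord x)^[n] 0)
      ⟨hm.aemeasurable, map_iterate_nextRecord_infinitePi_expMeasure hr n hn⟩ h
  refine h'.congr ?_
  have hpos : ∀ᵐ ω ∂P, 0 < X 0 ω := by
    have : ∀ᵐ t ∂(expMeasure r), 0 < t := by
      rw [ae_iff]
      simpa [← Iic_def] using expMeasure_Iic hr 0
    exact ae_of_ae_map (hX 0).aemeasurable ((hX 0).map_eq ▸ this)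
  filter_upwards [hpos] with ω hω
  exact upperRecord_eq_iterate_nextRecord_zero _ hω n hn

/-! ### Ratio of independent gamma variables -/

theorem lintegral_Ioo_mul_right (f : ℝ → ℝ≥0∞) (s t : ℝ) {v : ℝ} (hv : 0 < v) :
    ∫⁻ u in Ioo (s * v) (t * v), f u = ∫⁻ w in Ioo s t, ENNReal.ofReal v * f (w * v) := by
  have h := lintegral_image_eq_lintegral_abs_deriv_mul (s := Ioo s t) (f := fun w => w * v)
    (f' := fun _ => v) measurableSet_Ioo (fun w _ => (hasDerivAt_mul_const v).hasDerivWithinAt)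
    (fun x _ y _ h => mul_right_cancel₀ hv.ne' h) f
  rwa [Set.image_mul_right_Ioo _ _ hv, abs_of_pos hv] at h

/-- The density of the ratio of two independent gamma variables. -/
noncomputable def gammaRatioPDFReal (a b r q w : ℝ) : ℝ :=
  r ^ a * q ^ b / beta a b * w ^ (a - 1) / (r * w + q) ^ (a + b)

/-- As a function of `v`, the integrand is a constant times the gamma density of shape `a + b` and
rate `r * w + q`, whose total mass is one. -/
theorem lintegral_gammaPDF_mul_gammaPDF_ratio {a b r q w : ℝ} (ha : 0 < a) (hb : 0 < b)
    (hr : 0 < r) (hq : 0 < q) (hw : 0 < w) :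
    ∫⁻ v, gammaPDF b q v * (ENNReal.ofReal v * gammaPDF a r (w * v))
      = ENNReal.ofReal (gammaRatioPDFReal a b r q w) := by
  have hΓa := Real.Gamma_pos_of_pos ha
  have hΓb := Real.Gamma_pos_of_pos hb
  have hΓ := Real.Gamma_pos_of_pos (add_pos ha hb)
  have hbeta := beta_pos ha hb
  have hrq : 0 < r * w + q := by positivity
  have hD : 0 ≤ gammaRatioPDFReal a b r q w := by
    unfold gammaRatioPDFReal
    positivity
  rw [← mul_one (ENNReal.ofReal (gammaRatioPDFReal a b r q w)),
    ← lintegral_gammaPDF_eq_one (add_pos ha hb) hrq, ← lintegral_const_mul _ (by fun_prop)]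
  refine lintegral_congr_ae ?_
  filter_upwards [Measure.ae_ne volume (0 : ℝ)] with v hv
  rcases lt_or_gt_of_ne hv with h | h
  · simp [gammaPDF_of_neg h]
  · rw [gammaPDF_of_nonneg h.le, gammaPDF_of_nonneg (by positivity), gammaPDF_of_nonneg h.le,
      ← ENNReal.ofReal_mul (by positivity), ← ENNReal.ofReal_mul (by positivity),
      ← ENNReal.ofReal_mul hD]
    congr 1
    have he : Real.exp (-((r * w + q) * v)) = Real.exp (-(q * v)) * Real.exp (-(r * (w * v))) := by
      rw [← Real.exp_add]; congr 1; ring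
    have hp : v ^ (a + b - 1) = v ^ (b - 1) * v * v ^ (a - 1) := by
      rw [← Real.rpow_add_one h.ne', ← Real.rpow_add h]; congr 1; ring
    rw [he, hp, Real.mul_rpow hw.le h.le, gammaRatioPDFReal, beta]
    have := (Real.rpow_pos_of_pos hrq (a + b)).ne'
    field_simp

/-- Substitute `x = r w / (r w + q)`, for which `1 - x = q / (r w + q)` and `dx = r q / (r w + q)²
dw`. -/
theorem integral_gammaRatioPDFReal {a b r q : ℝ} (hr : 0 < r) (hq : 0 < q)
    {s t : ℝ} (hs : 0 ≤ s) (hst : s ≤ t) :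
    ∫ w in s..t, gammaRatioPDFReal a b r q w
      = (∫ x in (r * s / (r * s + q))..(r * t / (r * t + q)),
          x ^ (a - 1) * (1 - x) ^ (b - 1)) / beta a b := by
  have hden : ∀ x, s ≤ x → 0 < r * x + q := fun x hx => by
    have := hs.trans hx
    positivity
  have h := intervalIntegral.integral_comp_mul_deriv_of_deriv_nonneg (a := s) (b := t)
    (f := fun w => r * w / (r * w + q)) (f' := fun w => r * q / (r * w + q) ^ 2)
    (g := fun x => x ^ (a - 1) * (1 - x) ^ (b - 1)) ?_ ?_ ?_
  · rw [← h, ← intervalIntegral.integral_div]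
    refine intervalIntegral.integral_congr_Ioo_of_le hst fun w hw => ?_
    have hw0 : 0 < w := hs.trans_lt hw.1
    have hd := hden w hw.1.le
    have h1 : 1 - r * w / (r * w + q) = q / (r * w + q) := by
      field_simp
      ring
    simp only [Function.comp_apply, gammaRatioPDFReal]
    rw [h1, Real.div_rpow (by positivity) hd.le, Real.div_rpow hq.le hd.le,
      Real.mul_rpow hr.le hw0.le]
    have e1 : r ^ a = r ^ (a - 1) * r := by
      rw [← Real.rpow_add_one hr.ne']; congr 1; ring
    have e2 : q ^ b = q ^ (b - 1) * q := by
      rw [← Real.rpow_add_one hq.ne']; congr 1; ring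
    have e3 : (r * w + q) ^ (a + b)
        = (r * w + q) ^ (a - 1) * (r * w + q) ^ (b - 1) * (r * w + q) ^ 2 := by
      rw [← Real.rpow_natCast, ← Real.rpow_add hd, ← Real.rpow_add hd]
      congr 1
      push_cast
      ring
    rw [e1, e2, e3]
    have := (Real.rpow_pos_of_pos hd (a - 1)).ne'
    have := (Real.rpow_pos_of_pos hd (b - 1)).ne'
    field_simp
  · rw [uIcc_of_le hst]
    exact ContinuousOn.div (by fun_prop) (by fun_prop) fun x hx => (hden x hx.1).ne'
  · intro x hx
    rw [min_eq_left hst, max_eq_right hst] at hx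
    have hd := hden x hx.1.le
    have h1 : HasDerivAt (fun w => r * w) r x := hasDerivAt_const_mul r
    refine (h1.div (h1.add_const q) hd.ne').congr_deriv ?_
    congr 1
    ring
  · intro x hx
    positivity

theorem integrableOn_gammaRatioPDFReal {a b r q : ℝ} (ha : 1 ≤ a) (hr : 0 < r) (hq : 0 < q)
    {s : ℝ} (hs : 0 ≤ s) (t : ℝ) :
    IntegrableOn (gammaRatioPDFReal a b r q) (Icc s t) := by
  refine ContinuousOn.integrableOn_Icc ?_
  have hden : ∀ x ∈ Icc s t, 0 < r * x + q := fun x hx => by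
    have := hs.trans hx.1
    positivity
  refine ContinuousOn.div (Continuous.continuousOn ?_) ?_ fun x hx =>
    (Real.rpow_pos_of_pos (hden x hx) _).ne'
  · exact continuous_const.mul (Real.continuous_rpow_const (by linarith))
  · exact ContinuousOn.rpow_const (by fun_prop) fun x hx => Or.inl (hden x hx).ne'

theorem intervalIntegrable_rpow_mul_one_sub_rpow {a b : ℝ} (ha : 1 ≤ a) (hb : 1 ≤ b) (s t : ℝ) :
    IntervalIntegrable (fun x : ℝ => x ^ (a - 1) * (1 - x) ^ (b - 1)) volume s t :=
  ((Real.continuous_rpow_const (by linarith)).mul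
    ((Real.continuous_rpow_const (by linarith)).comp
      (continuous_const.sub continuous_id))).intervalIntegrable s t

theorem measurableSet_ratio_Ioo (s t : ℝ) :
    MeasurableSet {p : ℝ × ℝ | s < p.1 / p.2 ∧ p.1 / p.2 < t} :=
  (measurable_fst.div measurable_snd) measurableSet_Ioo

/-- The distribution of the ratio of two independent gamma variables in terms of the incomplete
beta function. -/
theorem gammaMeasure_prod_ratio_Ioo {a b r q : ℝ} (ha : 1 ≤ a) (hb : 1 ≤ b) (hr : 0 < r)
    (hq : 0 < q) {s t : ℝ} (hs : 0 ≤ s) (hst : s ≤ t) :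
    ((gammaMeasure a r).prod (gammaMeasure b q)).real
        {p : ℝ × ℝ | s < p.1 / p.2 ∧ p.1 / p.2 < t}
      = incompleteBeta (r * t / (r * t + q)) a b - incompleteBeta (r * s / (r * s + q)) a b := by
  have ha0 : 0 < a := by linarith
  have hb0 : 0 < b := by linarith
  have := isProbabilityMeasure_gammaMeasure ha0 hr
  have := isProbabilityMeasure_gammaMeasure hb0 hq
  have hI : incompleteBeta (r * t / (r * t + q)) a b - incompleteBeta (r * s / (r * s + q)) a b
      = ∫ w in s..t, gammaRatioPDFReal a b r q w := by
    rw [integral_gammaRatioPDFReal hr hq hs hst, incompleteBeta, incompleteBeta, ← sub_div,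
      intervalIntegral.integral_interval_sub_left
        (intervalIntegrable_rpow_mul_one_sub_rpow ha hb _ _)
        (intervalIntegrable_rpow_mul_one_sub_rpow ha hb _ _)]
  have hnn : ∀ w ∈ Ioo s t, 0 ≤ gammaRatioPDFReal a b r q w := fun w hw => by
    have := hs.trans_lt hw.1
    have := beta_pos ha0 hb0
    unfold gammaRatioPDFReal
    positivity
  have hlin : ((gammaMeasure a r).prod (gammaMeasure b q))
        {p : ℝ × ℝ | s < p.1 / p.2 ∧ p.1 / p.2 < t}
      = ∫⁻ w in Ioo s t, ENNReal.ofReal (gammaRatioPDFReal a b r q w) := by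
    -- For fixed `v > 0` the section of the cone is the interval `(s v, t v)`; scaling `u = w v`
    -- makes its endpoints independent of `v`, so Tonelli applies.
    have hsec : ∀ᵐ v : ℝ, gammaPDF b q v *
          gammaMeasure a r ((fun u => (u, v)) ⁻¹' {p : ℝ × ℝ | s < p.1 / p.2 ∧ p.1 / p.2 < t})
        = ∫⁻ w in Ioo s t, gammaPDF b q v * (ENNReal.ofReal v * gammaPDF a r (w * v)) := by
      filter_upwards [Measure.ae_ne volume (0 : ℝ)] with v hv
      rcases lt_or_gt_of_ne hv with h | h
      · simp [gammaPDF_of_neg h]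
      · have hset : (fun u => (u, v)) ⁻¹' {p : ℝ × ℝ | s < p.1 / p.2 ∧ p.1 / p.2 < t}
            = Ioo (s * v) (t * v) := by
          ext u
          simp [lt_div_iff₀ h, div_lt_iff₀ h]
        rw [hset, gammaMeasure, withDensity_apply _ measurableSet_Ioo,
          lintegral_Ioo_mul_right _ _ _ h, ← lintegral_const_mul _ (by fun_prop)]
    rw [Measure.prod_apply_symm (measurableSet_ratio_Ioo s t)]
    conv_lhs => rw [gammaMeasure.eq_1 b q]
    rw [lintegral_withDensity_eq_lintegral_mul _ (by fun_prop)
      (measurable_measure_prodMk_right (measurableSet_ratio_Ioo s t))]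
    simp only [Pi.mul_apply]
    rw [lintegral_congr_ae hsec, lintegral_lintegral_swap (by fun_prop)]
    exact setLIntegral_congr_fun measurableSet_Ioo fun w hw =>
      lintegral_gammaPDF_mul_gammaPDF_ratio ha0 hb0 hr hq (hs.trans_lt hw.1)
  rw [hI, measureReal_def, hlin, ← ofReal_integral_eq_lintegral_ofReal,
    intervalIntegral.integral_of_le hst, integral_Ioc_eq_integral_Ioo, ENNReal.toReal_ofReal]
  · exact setIntegral_nonneg measurableSet_Ioo hnn
  · exact (integrableOn_gammaRatioPDFReal ha hr hq hs t).mono_set Ioo_subset_Icc_self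
  · exact (ae_restrict_iff' measurableSet_Ioo).2 (ae_of_all _ hnn)

/-! ### Truncated moments by shifting the gamma shape -/

theorem ae_gammaMeasure_pos (a r : ℝ) : ∀ᵐ u ∂(gammaMeasure a r), 0 < u := by
  rw [gammaMeasure, ae_withDensity_iff (by fun_prop)]
  filter_upwards [Measure.ae_ne volume (0 : ℝ)] with u hu hpdf
  rcases lt_or_gt_of_ne hu with h | h
  · exact absurd (gammaPDF_of_neg h) hpdf
  · exact h

/-- The `i`-th moment of the gamma distribution. -/
noncomputable def gammaMoment (a r : ℝ) (i : ℕ) : ℝ :=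
  Real.Gamma (a + i) / (Real.Gamma a * r ^ i)

theorem gammaMoment_pos {a r : ℝ} (ha : 0 < a) (hr : 0 < r) (i : ℕ) : 0 < gammaMoment a r i := by
  have := Real.Gamma_pos_of_pos ha
  have := Real.Gamma_pos_of_pos (show 0 < a + i by positivity)
  unfold gammaMoment
  positivity

theorem gammaMeasure_withDensity_pow {a r : ℝ} (ha : 0 < a) (hr : 0 < r) (i : ℕ) :
    (gammaMeasure a r).withDensity (fun u => ENNReal.ofReal (u ^ i))
      = ENNReal.ofReal (gammaMoment a r i) • gammaMeasure (a + i) r := by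
  have hΓa := Real.Gamma_pos_of_pos ha
  have hΓ := Real.Gamma_pos_of_pos (show 0 < a + i by positivity)
  rw [gammaMeasure, gammaMeasure, ← withDensity_mul _ (by fun_prop) (by fun_prop),
    ← withDensity_smul _ (by fun_prop)]
  refine withDensity_congr_ae ?_
  filter_upwards [Measure.ae_ne volume (0 : ℝ)] with u hu
  rcases lt_or_gt_of_ne hu with h | h
  · simp [gammaPDF_of_neg h]
  · simp only [Pi.mul_apply, Pi.smul_apply, smul_eq_mul]
    rw [gammaPDF_of_nonneg h.le, gammaPDF_of_nonneg h.le, ← ENNReal.ofReal_mul (by positivity),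
      ← ENNReal.ofReal_mul (gammaMoment_pos ha hr i).le]
    congr 1
    have e1 : u ^ (a + i - 1) = u ^ (a - 1) * u ^ i := by
      rw [← Real.rpow_natCast, ← Real.rpow_add h]; congr 1; ring
    rw [e1, Real.rpow_add hr, Real.rpow_natCast, gammaMoment]
    field_simp

/-- The weight `u^i v^j` factorizes, so the weighted product measure is again a product of gamma
laws, up to a constant, and no integral over `A` has to be computed. -/
theorem integrableOn_and_setIntegral_pow_mul_pow {a b r q : ℝ} (ha : 0 < a) (hb : 0 < b)
    (hr : 0 < r) (hq : 0 < q) (i j : ℕ) {A : Set (ℝ × ℝ)} (hA : MeasurableSet A) :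
    IntegrableOn (fun p : ℝ × ℝ => p.1 ^ i * p.2 ^ j) A
        ((gammaMeasure a r).prod (gammaMeasure b q)) ∧
      ∫ p in A, p.1 ^ i * p.2 ^ j ∂((gammaMeasure a r).prod (gammaMeasure b q))
        = gammaMoment a r i * gammaMoment b q j *
          ((gammaMeasure (a + i) r).prod (gammaMeasure (b + j) q)).real A := by
  have := isProbabilityMeasure_gammaMeasure ha hr
  have := isProbabilityMeasure_gammaMeasure hb hq
  have := isProbabilityMeasure_gammaMeasure (show 0 < a + i by positivity) hr
  have := isProbabilityMeasure_gammaMeasure (show 0 < b + j by positivity) hq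
  have hmi := gammaMoment_pos ha hr i
  have hmj := gammaMoment_pos hb hq j
  have hpos : ∀ᵐ p ∂((gammaMeasure a r).prod (gammaMeasure b q)), 0 < p.1 ∧ 0 < p.2 :=
    (Measure.quasiMeasurePreserving_fst.ae (ae_gammaMeasure_pos a r)).and
      (Measure.quasiMeasurePreserving_snd.ae (ae_gammaMeasure_pos b q))
  have hlin : ∫⁻ p in A, ENNReal.ofReal (p.1 ^ i * p.2 ^ j)
        ∂((gammaMeasure a r).prod (gammaMeasure b q))
      = ENNReal.ofReal (gammaMoment a r i * gammaMoment b q j) *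
          ((gammaMeasure (a + i) r).prod (gammaMeasure (b + j) q)) A := by
    have h1 : ∫⁻ p in A, ENNReal.ofReal (p.1 ^ i * p.2 ^ j)
          ∂((gammaMeasure a r).prod (gammaMeasure b q))
        = ∫⁻ p in A, ENNReal.ofReal (p.1 ^ i) * ENNReal.ofReal (p.2 ^ j)
          ∂((gammaMeasure a r).prod (gammaMeasure b q)) := by
      refine lintegral_congr_ae (ae_restrict_of_ae ?_)
      filter_upwards [hpos] with p hp
      exact ENNReal.ofReal_mul (pow_nonneg hp.1.le _)
    rw [h1, ← withDensity_apply _ hA, ← prod_withDensity (f := fun u => ENNReal.ofReal (u ^ i))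
        (g := fun v => ENNReal.ofReal (v ^ j)) (by fun_prop) (by fun_prop),
      gammaMeasure_withDensity_pow ha hr, gammaMeasure_withDensity_pow hb hq,
      Measure.prod_smul_left, Measure.prod_smul_right, smul_smul, Measure.smul_apply, smul_eq_mul,
      ENNReal.ofReal_mul hmi.le]
  have hnn : 0 ≤ᵐ[((gammaMeasure a r).prod (gammaMeasure b q)).restrict A]
      fun p : ℝ × ℝ => p.1 ^ i * p.2 ^ j := by
    refine ae_restrict_of_ae ?_
    filter_upwards [hpos] with p hp
    exact mul_nonneg (pow_nonneg hp.1.le _) (pow_nonneg hp.2.le _)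
  have hmeas : AEStronglyMeasurable (fun p : ℝ × ℝ => p.1 ^ i * p.2 ^ j)
      (((gammaMeasure a r).prod (gammaMeasure b q)).restrict A) := by fun_prop
  constructor
  · refine ⟨hmeas, ?_⟩
    rw [hasFiniteIntegral_iff_ofReal hnn, hlin]
    exact ENNReal.mul_lt_top ENNReal.ofReal_lt_top (measure_lt_top _ _)
  · rw [integral_eq_lintegral_of_nonneg_ae hnn hmeas, hlin, ENNReal.toReal_mul,
      ENNReal.toReal_ofReal (by positivity), measureReal_def]

/-! ### Sign and order of the critical values -/

theorem isProbabilityMeasure_fisherMeasure {k l : ℕ} (hk : 0 < k) (hl : 0 < l) :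
    IsProbabilityMeasure (fisherMeasure k l) := by
  have : IsProbabilityMeasure (chiSquareMeasure k) :=
    isProbabilityMeasure_gammaMeasure (by positivity) (by norm_num)
  have : IsProbabilityMeasure (chiSquareMeasure l) :=
    isProbabilityMeasure_gammaMeasure (by positivity) (by norm_num)
  exact Measure.isProbabilityMeasure_map (by fun_prop)

theorem ae_fisherMeasure_nonneg {k l : ℕ} (hk : 0 < k) (hl : 0 < l) :
    ∀ᵐ z ∂(fisherMeasure k l), 0 ≤ z := by
  have : IsProbabilityMeasure (chiSquareMeasure k) :=
    isProbabilityMeasure_gammaMeasure (by positivity) (by norm_num)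
  have : IsProbabilityMeasure (chiSquareMeasure l) :=
    isProbabilityMeasure_gammaMeasure (by positivity) (by norm_num)
  have hpos : ∀ᵐ p ∂((chiSquareMeasure k).prod (chiSquareMeasure l)), 0 < p.1 ∧ 0 < p.2 :=
    (Measure.quasiMeasurePreserving_fst.ae (ae_gammaMeasure_pos _ _)).and
      (Measure.quasiMeasurePreserving_snd.ae (ae_gammaMeasure_pos _ _))
  refine (ae_map_iff (by fun_prop) measurableSet_Ici).2 ?_
  filter_upwards [hpos] with p hp
  have := hp.1
  have := hp.2
  positivity

section Quantile

variable {μ : Measure ℝ} [IsProbabilityMeasure μ]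

theorem nonneg_of_le_cdf (hμ : ∀ᵐ z ∂μ, 0 ≤ z) {p x : ℝ} (hp : 0 < p) (hx : p ≤ cdf μ x) :
    0 ≤ x := by
  by_contra! h
  have h0 : cdf μ x = 0 := by
    rw [cdf_eq_real, measureReal_eq_zero_iff]
    refine measure_mono_null (fun z hz => ?_) (ae_iff.1 hμ)
    exact not_le.2 (lt_of_le_of_lt hz h)
  linarith

theorem quantile_nonneg (hμ : ∀ᵐ z ∂μ, 0 ≤ z) {p : ℝ} (hp : 0 < p) : 0 ≤ quantile μ p :=
  Real.sInf_nonneg fun _ hx => nonneg_of_le_cdf hμ hp hx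

/-- The defining sets are nested and bounded below by `0`; `q < 1` makes the smaller one nonempty,
excluding the default value of `sInf ∅`. -/
theorem quantile_le_quantile (hμ : ∀ᵐ z ∂μ, 0 ≤ z) {p q : ℝ} (hp : 0 < p) (hpq : p ≤ q)
    (hq : q < 1) : quantile μ p ≤ quantile μ q := by
  refine csInf_le_csInf ⟨0, fun x hx => nonneg_of_le_cdf hμ hp hx⟩ ?_ fun x hx => hpq.trans hx
  obtain ⟨x, hx⟩ := ((tendsto_cdf_atTop μ).eventually (lt_mem_nhds hq)).exists
  exact ⟨x, hx.le⟩

end Quantile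

/-! ### Integrals carried together with integrability -/

/-- `f` is integrable with integral `I`. -/
def HasIntegralEq {Ω : Type*} [MeasurableSpace Ω] (μ : Measure Ω) (f : Ω → ℝ) (I : ℝ) : Prop :=
  Integrable f μ ∧ ∫ ω, f ω ∂μ = I

namespace HasIntegralEq

variable {Ω : Type*} [MeasurableSpace Ω] {μ : Measure Ω} {f g : Ω → ℝ} {I J : ℝ}

theorem add (hf : HasIntegralEq μ f I) (hg : HasIntegralEq μ g J) :
    HasIntegralEq μ (fun ω => f ω + g ω) (I + J) :=
  ⟨hf.1.add hg.1, by rw [integral_add hf.1 hg.1, hf.2, hg.2]⟩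

theorem const_mul (hf : HasIntegralEq μ f I) (c : ℝ) :
    HasIntegralEq μ (fun ω => c * f ω) (c * I) :=
  ⟨hf.1.const_mul c, by rw [integral_const_mul, hf.2]⟩

theorem congr (hf : HasIntegralEq μ f I) (hfg : ∀ ω, g ω = f ω) (hIJ : J = I) :
    HasIntegralEq μ g J := by
  rw [funext hfg, hIJ]
  exact hf

theorem of_hasLaw {Ω' : Type*} [MeasurableSpace Ω'] {ν : Measure Ω'} {Z : Ω' → Ω}
    (hZ : HasLaw Z μ ν) (hf : HasIntegralEq μ f I) : HasIntegralEq ν (fun ω => f (Z ω)) I := by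
  have hfm : AEStronglyMeasurable f (ν.map Z) := hZ.map_eq ▸ hf.1.aestronglyMeasurable
  constructor
  · exact (integrable_map_measure hfm hZ.aemeasurable).1 (hZ.map_eq ▸ hf.1)
  · rw [← integral_map hZ.aemeasurable hfm, hZ.map_eq, hf.2]

end HasIntegralEq

theorem gammaMoment_zero {a r : ℝ} (ha : 0 < a) : gammaMoment a r 0 = 1 := by
  have := (Real.Gamma_pos_of_pos ha).ne'
  simp [gammaMoment, this]

theorem gammaMoment_one {a r : ℝ} (ha : 0 < a) : gammaMoment a r 1 = a / r := by
  have := (Real.Gamma_pos_of_pos ha).ne'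
  rw [gammaMoment, Nat.cast_one, Real.Gamma_add_one ha.ne']
  field_simp

theorem gammaMoment_two {a r : ℝ} (ha : 0 < a) : gammaMoment a r 2 = a * (a + 1) / r ^ 2 := by
  have := (Real.Gamma_pos_of_pos ha).ne'
  have h2 : a + ((2 : ℕ) : ℝ) = a + 1 + 1 := by push_cast; ring
  rw [gammaMoment, h2, Real.Gamma_add_one (by positivity), Real.Gamma_add_one ha.ne']
  field_simp

theorem hasIntegralEq_indicator_pow_mul_pow {a b r q : ℝ} (ha : 0 < a) (hb : 0 < b)
    (hr : 0 < r) (hq : 0 < q) (i j : ℕ) {A : Set (ℝ × ℝ)} (hA : MeasurableSet A) :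
    HasIntegralEq ((gammaMeasure a r).prod (gammaMeasure b q))
      (A.indicator fun p => p.1 ^ i * p.2 ^ j)
      (gammaMoment a r i * gammaMoment b q j *
        ((gammaMeasure (a + i) r).prod (gammaMeasure (b + j) q)).real A) := by
  have h := integrableOn_and_setIntegral_pow_mul_pow ha hb hr hq i j hA
  exact ⟨(integrable_indicator_iff hA).2 h.1, by rw [integral_indicator hA, h.2]⟩

theorem hasIntegralEq_fst_pow {a b r q : ℝ} (ha : 0 < a) (hb : 0 < b)
    (hr : 0 < r) (hq : 0 < q) (i : ℕ) :
    HasIntegralEq ((gammaMeasure a r).prod (gammaMeasure b q)) (fun p => p.1 ^ i)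
      (gammaMoment a r i) := by
  have := isProbabilityMeasure_gammaMeasure (show 0 < a + i by positivity) hr
  have := isProbabilityMeasure_gammaMeasure (show 0 < b + (0 : ℕ) by simpa using hb) hq
  refine (hasIntegralEq_indicator_pow_mul_pow ha hb hr hq i 0 MeasurableSet.univ).congr
    (fun p => by simp) ?_
  rw [gammaMoment_zero hb, probReal_univ]
  simp

/-! ### The estimator as a function of two records -/

/-- The joint law of the two record values. -/
theorem hasLaw_upperRecord_prod {Ω : Type*} [MeasurableSpace Ω] {P : Measure Ω}
    [IsProbabilityMeasure P] {X Y : ℕ → Ω → ℝ} {r q : ℝ} (hr : 0 < r) (hq : 0 < q)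
    (hX : ∀ i, HasLaw (X i) (expMeasure r) P) (hY : ∀ i, HasLaw (Y i) (expMeasure q) P)
    (hXind : iIndepFun X P) (hYind : iIndepFun Y P)
    (hXY : IndepFun (fun ω i => X i ω) (fun ω i => Y i ω) P)
    {n m : ℕ} (hn : 1 ≤ n) (hm : 1 ≤ m) :
    HasLaw (fun ω => (upperRecord (fun i => X i ω) n, upperRecord (fun i => Y i ω) m))
      ((gammaMeasure n r).prod (gammaMeasure m q)) P := by
  have hU := hasLaw_upperRecord hr hX hXind n hn
  have hV := hasLaw_upperRecord hq hY hYind m hm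
  have hind : IndepFun (fun ω => upperRecord (fun i => X i ω) n)
      (fun ω => upperRecord (fun i => Y i ω) m) P :=
    hXY.comp (measurable_upperRecord n) (measurable_upperRecord m)
  refine ⟨hU.aemeasurable.prodMk hV.aemeasurable, ?_⟩
  rw [(indepFun_iff_map_prod_eq_prod_map_map hU.aemeasurable hV.aemeasurable).1 hind, hU.map_eq,
    hV.map_eq]

/-- Pooling moves `θ̂₁` by `λ (θ̂₂ - θ̂₁)`, so shrinking adds `K λ` times this difference on
acceptance; passing from estimators to records rescales the critical values by `n₁ / n₂`. -/
theorem shrinkageEstimator_eq {n₁ n₂ : ℕ} (hn₁ : 1 ≤ n₁) (hn₂ : 1 ≤ n₂) (α K : ℝ)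
    (x y : ℕ → ℝ) :
    shrinkageEstimator n₁ n₂ α K x y
      = upperRecord x n₁ / n₁ +
        {p : ℝ × ℝ | critLower n₁ n₂ α * n₁ / n₂ < p.1 / p.2 ∧
            p.1 / p.2 < critUpper n₁ n₂ α * n₁ / n₂}.indicator
          (fun p => K * (n₂ / (n₁ + n₂)) * (p.2 / n₂ - p.1 / n₁))
          (upperRecord x n₁, upperRecord y n₂) := by
  have h1 : (0 : ℝ) < n₁ := by exact_mod_cast hn₁
  have h2 : (0 : ℝ) < n₂ := by exact_mod_cast hn₂
  generalize hu : upperRecord x n₁ = u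
  generalize hv : upperRecord y n₂ = v
  have hratio : u / n₁ / (v / n₂) = u / v * n₂ / n₁ := by
    -- At `v = 0` both sides vanish because division by zero gives zero.
    rcases eq_or_ne v 0 with rfl | hv0
    · simp
    · field_simp
  have hiff : (critLower n₁ n₂ α < u / n₁ / (v / n₂) ∧ u / n₁ / (v / n₂) < critUpper n₁ n₂ α) ↔
      (u, v) ∈ {p : ℝ × ℝ | critLower n₁ n₂ α * n₁ / n₂ < p.1 / p.2 ∧
        p.1 / p.2 < critUpper n₁ n₂ α * n₁ / n₂} := by
    rw [hratio, mem_ofPred_eq, lt_div_iff₀ h1, div_lt_iff₀ h1, div_lt_iff₀ h2, lt_div_iff₀ h2]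
  unfold shrinkageEstimator scaleMLE pooledEstimator
  rw [hu, hv]
  by_cases h : critLower n₁ n₂ α < u / n₁ / (v / n₂) ∧ u / n₁ / (v / n₂) < critUpper n₁ n₂ α
  · rw [if_pos h, indicator_of_mem (hiff.1 h)]
    field_simp
    ring
  · rw [if_neg h, indicator_of_notMem (fun h' => h (hiff.2 h')), add_zero]

theorem critLower_nonneg {n₁ n₂ : ℕ} (hn₁ : 1 ≤ n₁) (hn₂ : 1 ≤ n₂) {α : ℝ} (hα : 0 < α) :
    0 ≤ critLower n₁ n₂ α := by
  have := isProbabilityMeasure_fisherMeasure (k := 2 * n₁) (l := 2 * n₂) (by omega) (by omega)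
  exact quantile_nonneg (ae_fisherMeasure_nonneg (by omega) (by omega)) (by linarith)

theorem critLower_le_critUpper {n₁ n₂ : ℕ} (hn₁ : 1 ≤ n₁) (hn₂ : 1 ≤ n₂) {α : ℝ} (hα : 0 < α)
    (hα' : α ≤ 1) : critLower n₁ n₂ α ≤ critUpper n₁ n₂ α := by
  have := isProbabilityMeasure_fisherMeasure (k := 2 * n₁) (l := 2 * n₂) (by omega) (by omega)
  exact quantile_le_quantile (ae_fisherMeasure_nonneg (by omega) (by omega)) (by linarith)
    (by linarith) (by linarith)

theorem lemma2 {Ω : Type*} [MeasurableSpace Ω] (P : Measure Ω) [IsProbabilityMeasure P]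
    (X Y : ℕ → Ω → ℝ) (θ₁ θ₂ : ℝ) (hθ₁ : 0 < θ₁) (hθ₂ : 0 < θ₂)
    (hXm : ∀ i, Measurable (X i)) (hYm : ∀ i, Measurable (Y i))
    (hX : ∀ i, HasLaw (X i) (expMeasure (1 / θ₁)) P)
    (hY : ∀ i, HasLaw (Y i) (expMeasure (1 / θ₂)) P)
    (hXind : iIndepFun X P) (hYind : iIndepFun Y P)
    (hXY : IndepFun (fun ω i => X i ω) (fun ω i => Y i ω) P)
    (n₁ n₂ : ℕ) (hn₁ : 1 ≤ n₁) (hn₂ : 1 ≤ n₂)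
    (α : ℝ) (hα : 0 < α) (hα' : α ≤ 1) (K : ℝ) :
    let S : Ω → ℝ := fun ω =>
      shrinkageEstimator n₁ n₂ α K (fun i => X i ω) (fun i => Y i ω)
    let δ : ℝ := θ₂ / θ₁
    let l : ℝ := (n₂ : ℝ) / (n₁ + n₂)
    let d₁ : ℝ := 1 - n₂ / (n₂ + critLower n₁ n₂ α * n₁ * δ)
    let d₂ : ℝ := 1 - n₂ / (n₂ + critUpper n₁ n₂ α * n₁ * δ)
    let J : ℝ → ℝ → ℝ := fun a b => incompleteBeta d₂ a b - incompleteBeta d₁ a b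
    (Integrable S P ∧
      (∫ ω, S ω ∂P) - θ₁ =
        - K * l * (θ₁ * J (n₁ + 1) n₂) + K * l * (θ₂ * J n₁ (n₂ + 1))) ∧
    (Integrable (fun ω => (S ω - θ₁) ^ 2) P ∧
      ∫ ω, (S ω - θ₁) ^ 2 ∂P =
        (n₁ + 1) / n₁ * θ₁ ^ 2
        + (K ^ 2 * l ^ 2 - 2 * K * l) * θ₁ ^ 2 * ((n₁ + 1) / n₁) * J (n₁ + 2) n₂
        + K ^ 2 * l ^ 2 * θ₂ ^ 2 * ((n₂ + 1) / n₂) * J n₁ (n₂ + 2)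
        + 2 * (K * l - K ^ 2 * l ^ 2) * θ₁ * θ₂ * J (n₁ + 1) (n₂ + 1)
        - 2 * θ₁ ^ 2
        - 2 * K * l * θ₁ * θ₂ * J n₁ (n₂ + 1)
        + 2 * K * l * θ₁ ^ 2 * J (n₁ + 1) n₂
        + θ₁ ^ 2) := by
  intro S δ l d₁ d₂ J
  have h1 : (1 : ℝ) ≤ n₁ := by exact_mod_cast hn₁
  have h2 : (1 : ℝ) ≤ n₂ := by exact_mod_cast hn₂
  have h10 : (0 : ℝ) < n₁ := by linarith
  have h20 : (0 : ℝ) < n₂ := by linarith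
  have hr₁ : 0 < 1 / θ₁ := by positivity
  have hr₂ : 0 < 1 / θ₂ := by positivity
  have hc₁ := critLower_nonneg hn₁ hn₂ hα
  have hc := critLower_le_critUpper hn₁ hn₂ hα hα'
  have hc₂ := hc₁.trans hc
  set c₁ := critLower n₁ n₂ α
  set c₂ := critUpper n₁ n₂ α
  set A : Set (ℝ × ℝ) := {p | c₁ * n₁ / n₂ < p.1 / p.2 ∧ p.1 / p.2 < c₂ * n₁ / n₂} with hA
  have hAm : MeasurableSet A := measurableSet_ratio_Ioo _ _
  -- The beta endpoint `r s / (r s + q)` at `s = c n₁ / n₂` is exactly `d₁` or `d₂`.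
  have hd : ∀ c : ℝ, 0 ≤ c → 1 / θ₁ * (c * n₁ / n₂) / (1 / θ₁ * (c * n₁ / n₂) + 1 / θ₂)
      = 1 - n₂ / (n₂ + c * n₁ * δ) := by
    intro c hc
    have : 0 < n₂ * θ₁ + c * n₁ * θ₂ := by positivity
    have : 0 < c * n₁ * θ₂ + n₂ * θ₁ := by positivity
    simp only [δ]
    field_simp
    ring
  have hJ : ∀ a b : ℝ, 1 ≤ a → 1 ≤ b →
      ((gammaMeasure a (1 / θ₁)).prod (gammaMeasure b (1 / θ₂))).real A = J a b := by
    intro a b ha hb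
    rw [hA, gammaMeasure_prod_ratio_Ioo ha hb hr₁ hr₂ (by positivity) (by gcongr), hd _ hc₁,
      hd _ hc₂]
  have hlaw := hasLaw_upperRecord_prod hr₁ hr₂ hX hY hXind hYind hXY hn₁ hn₂
  have hS : ∀ ω, S ω = upperRecord (fun i => X i ω) n₁ / n₁ + A.indicator
      (fun p => K * l * (p.2 / n₂ - p.1 / n₁))
      (upperRecord (fun i => X i ω) n₁, upperRecord (fun i => Y i ω) n₂) :=
    fun ω => shrinkageEstimator_eq hn₁ hn₂ α K _ _
  have m₁ := gammaMoment_one (r := 1 / θ₁) h10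
  have m₂ := gammaMoment_two (r := 1 / θ₁) h10
  have m₀ := gammaMoment_zero (r := 1 / θ₁) h10
  have k₁ := gammaMoment_one (r := 1 / θ₂) h20
  have k₂ := gammaMoment_two (r := 1 / θ₂) h20
  have k₀ := gammaMoment_zero (r := 1 / θ₂) h20
  have u₀ := hasIntegralEq_fst_pow h10 h20 hr₁ hr₂ 0
  have u₁ := hasIntegralEq_fst_pow h10 h20 hr₁ hr₂ 1
  have u₂ := hasIntegralEq_fst_pow h10 h20 hr₁ hr₂ 2
  have e₁₀ := hasIntegralEq_indicator_pow_mul_pow h10 h20 hr₁ hr₂ 1 0 hAm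
  have e₀₁ := hasIntegralEq_indicator_pow_mul_pow h10 h20 hr₁ hr₂ 0 1 hAm
  have e₂₀ := hasIntegralEq_indicator_pow_mul_pow h10 h20 hr₁ hr₂ 2 0 hAm
  have e₁₁ := hasIntegralEq_indicator_pow_mul_pow h10 h20 hr₁ hr₂ 1 1 hAm
  have e₀₂ := hasIntegralEq_indicator_pow_mul_pow h10 h20 hr₁ hr₂ 0 2 hAm
  rw [hJ _ _ (by push_cast; linarith) (by push_cast; linarith)] at e₁₀ e₀₁ e₂₀ e₁₁ e₀₂
  simp only [m₀, m₁, m₂, k₀, k₁, k₂, Nat.cast_zero, Nat.cast_one, Nat.cast_ofNat, add_zero]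
    at u₀ u₁ u₂ e₁₀ e₀₁ e₂₀ e₁₁ e₀₂
  have hbias : HasIntegralEq P S
      (θ₁ + (- K * l * (θ₁ * J (n₁ + 1) n₂) + K * l * (θ₂ * J n₁ (n₂ + 1)))) := by
    -- The coefficients of `u`, `1_A u` and `1_A v` in the estimator.
    refine (HasIntegralEq.of_hasLaw hlaw (((u₁.const_mul (1 / n₁)).add
      (e₁₀.const_mul (-(K * l) / n₁))).add (e₀₁.const_mul (K * l / n₂)))).congr (fun ω => ?_) ?_
    · rw [hS]
      by_cases h : (upperRecord (fun i => X i ω) n₁, upperRecord (fun i => Y i ω) n₂) ∈ A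
      · simp only [indicator_of_mem h]
        ring
      · simp only [indicator_of_notMem h]
        ring
    · field_simp
      ring
  have hmse : HasIntegralEq P (fun ω => (S ω - θ₁) ^ 2)
      ((n₁ + 1) / n₁ * θ₁ ^ 2
        + (K ^ 2 * l ^ 2 - 2 * K * l) * θ₁ ^ 2 * ((n₁ + 1) / n₁) * J (n₁ + 2) n₂
        + K ^ 2 * l ^ 2 * θ₂ ^ 2 * ((n₂ + 1) / n₂) * J n₁ (n₂ + 2)
        + 2 * (K * l - K ^ 2 * l ^ 2) * θ₁ * θ₂ * J (n₁ + 1) (n₂ + 1)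
        - 2 * θ₁ ^ 2
        - 2 * K * l * θ₁ * θ₂ * J n₁ (n₂ + 1)
        + 2 * K * l * θ₁ ^ 2 * J (n₁ + 1) n₂
        + θ₁ ^ 2) := by
    -- Expansion of the square with `1_A² = 1_A`: first the untruncated `(u/n₁ - θ₁)²`, then the
    -- terms on `A`. The cross term contributes the parts linear in `K λ`, the squared correction
    -- those in `K² λ²`.
    refine (HasIntegralEq.of_hasLaw hlaw ((((((((u₂.const_mul (1 / n₁ ^ 2)).add
      (u₁.const_mul (-(2 * θ₁) / n₁))).add (u₀.const_mul (θ₁ ^ 2))).add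
      (e₂₀.const_mul ((K ^ 2 * l ^ 2 - 2 * (K * l)) / n₁ ^ 2))).add
      (e₁₁.const_mul (2 * (K * l - K ^ 2 * l ^ 2) / (n₁ * n₂)))).add
      (e₀₂.const_mul (K ^ 2 * l ^ 2 / n₂ ^ 2))).add
      (e₁₀.const_mul (2 * θ₁ * (K * l) / n₁))).add
      (e₀₁.const_mul (-(2 * θ₁ * (K * l)) / n₂)))).congr (fun ω => ?_) ?_
    · rw [hS]
      by_cases h : (upperRecord (fun i => X i ω) n₁, upperRecord (fun i => Y i ω) n₂) ∈ A
      · simp only [indicator_of_mem h]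
        field_simp
        ring
      · simp only [indicator_of_notMem h]
        field_simp
        ring
    · field_simp
      ring
  exact ⟨⟨hbias.1, by rw [hbias.2]; ring⟩, hmse⟩
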